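/- Let $m,n,k$ be non-negative integers and let $F:[0,\infty)\to[0,\infty)$ be non-decreasing and a sparseness measure, i.e. $F(|x+y|)\le F(|x|)+F(|y|)$ for all $x,y\in\mathbb{R}$, and $F(x)=0$ if and only if $x=0$. For $\mathbf{x}\in\mathbb{R}^n$ put $J(\mathbf{x})=\sum_{i=1}^n F(|x_i|)$; call $\mathbf{x}$ $k$-sparse if it has at most $k$ non-zero entries; and let $\|\cdot\|$ denote the Euclidean norm. A matrix $\mathbf{A}\in\mathbb{R}^{m\times n}$ satisfies - the exact recovery condition (ERC) if for every $k$-sparse $\bar{\mathbf{x}}\in\mathbb{R}^n$, $\bar{\mathbf{x}}$ is the unique solution of the problem of minimizing $J(\mathbf{x})$ over $\mathbf{x}\in\mathbb{R}^n$ subject to $\mathbf{A}\mathbf{x}=\mathbf{A}\bar{\mathbf{x}}$; - the robust recovery condition (RRC) if there is a constant $C$ such that for every $k$-sparse $\bar{\mathbf{x}}\in\mathbb{R}^n$, every $\epsilon>0$, every $\mathbf{v}\in\mathbb{R}^m$ with $\|\mathbf{v}\|\le\epsilon$, and every $\hat{\mathbf{x}}\in\mathbb{R}^n$ with $\|\mathbf{A}\hat{\mathbf{x}}-(\mathbf{A}\bar{\mathbf{x}}+\mathbf{v})\|<\epsilon$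 and $J(\hat{\mathbf{x}})\le J(\bar{\mathbf{x}})$, we have $\|\bar{\mathbf{x}}-\hat{\mathbf{x}}\|<C\epsilon$. Let $\mathbf{A}$ be a random $m\times n$ real matrix whose distribution is absolutely continuous with respect to the Lebesgue measure on $\mathbb{R}^{m\times n}$. Then the events "$\mathbf{A}$ satisfies ERC" and "$\mathbf{A}$ satisfies RRC" are measurable with respect to the completion of the underlying probability measure, and they have the same probability. In particular, this holds when the entries of $\mathbf{A}$ are i.i.d. with a common distribution that is absolutely continuous with respect to the Lebesgue measure on $\mathbb{R}$. -/

import Mathlib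

open MeasureTheory ProbabilityTheory
open scoped NNReal

namespace FMin

/-- A sparseness measure: `F : [0,∞) → [0,∞)` such that `F(|·|)` is subadditive on `ℝ` and
`F` vanishes exactly at `0`. -/
structure IsSparsenessMeasure (F : ℝ≥0 → ℝ≥0) : Prop where
  subadditive : ∀ x y : ℝ, F (Real.nnabs (x + y)) ≤ F (Real.nnabs x) + F (Real.nnabs y)
  eq_zero_iff : ∀ x : ℝ≥0, F x = 0 ↔ x = 0

/-- The cost function `J(x) = ∑ i, F(|x i|)`. -/
def cost {n : ℕ} (F : ℝ≥0 → ℝ≥0) (x : EuclideanSpace ℝ (Fin n)) : ℝ≥0 :=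
  ∑ i, F (Real.nnabs (x i))

/-- `x` has at most `k` non-zero coordinates. -/
def IsSparse {n : ℕ} (k : ℕ) (x : EuclideanSpace ℝ (Fin n)) : Prop :=
  {i | x i ≠ 0}.ncard ≤ k

/-- `x` is a solution of the problem: minimize `J` subject to `A x = y`. -/
def IsSolution {m n : ℕ} (F : ℝ≥0 → ℝ≥0) (A : Matrix (Fin m) (Fin n) ℝ)
    (y : EuclideanSpace ℝ (Fin m)) (x : EuclideanSpace ℝ (Fin n)) : Prop :=
  A.toEuclideanLin x = y ∧
    ∀ x' : EuclideanSpace ℝ (Fin n), A.toEuclideanLin x' = y → cost F x ≤ cost F x'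

/-- Exact recovery condition: every `k`-sparse `xbar` is the unique solution of the
noiseless problem with measurement `y = A xbar`. -/
def ERC {m n : ℕ} (F : ℝ≥0 → ℝ≥0) (k : ℕ) (A : Matrix (Fin m) (Fin n) ℝ) : Prop :=
  ∀ xbar : EuclideanSpace ℝ (Fin n), IsSparse k xbar →
    ∀ x : EuclideanSpace ℝ (Fin n), IsSolution F A (A.toEuclideanLin xbar) x ↔ x = xbar

/-- Robust recovery condition: with a constant `C` depending only on `A`, `k`, `F`, every `xhat`
that is feasible for the noisy measurement `y = A xbar + v` at tolerance `ε ≥ ‖v‖` and costs no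
more than the `k`-sparse `xbar` lies within `C ε` of `xbar`. Norms are Euclidean. -/
def RRC {m n : ℕ} (F : ℝ≥0 → ℝ≥0) (k : ℕ) (A : Matrix (Fin m) (Fin n) ℝ) : Prop :=
  ∃ C : ℝ, ∀ (xbar xhat : EuclideanSpace ℝ (Fin n)) (v : EuclideanSpace ℝ (Fin m)) (ε : ℝ),
    0 < ε → IsSparse k xbar → ‖v‖ ≤ ε →
    ‖A.toEuclideanLin xhat - (A.toEuclideanLin xbar + v)‖ < ε →
    cost F xhat ≤ cost F xbar →
    ‖xbar - xhat‖ < C * ε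

/-- The space of real `m × n` matrices with its product (Borel) σ-algebra and Lebesgue measure,
the product over all entries of Lebesgue measure on `ℝ`. -/
noncomputable instance instMeasureSpaceMatrix (m n : ℕ) :
    MeasureSpace (Matrix (Fin m) (Fin n) ℝ) :=
  inferInstanceAs (MeasureSpace (Fin m → Fin n → ℝ))

/-- The events that `A` satisfies ERC and that `A` satisfies RRC both have a well-defined
probability (they are measurable for the completion of `P`), and these probabilities agree. -/
def SameProbability {Ω : Type*} [MeasurableSpace Ω] (P : Measure Ω) {m n : ℕ}
    (F : ℝ≥0 → ℝ≥0) (k : ℕ) (A : Ω → Matrix (Fin m) (Fin n) ℝ) : Prop :=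
  NullMeasurableSet {ω | ERC F k (A ω)} P ∧ NullMeasurableSet {ω | RRC F k (A ω)} P ∧
    P {ω | ERC F k (A ω)} = P {ω | RRC F k (A ω)}

end FMin

/-!
ERC implies that the kernel of `A` meets certain cones, one for each set `S` of at most `k`
coordinates, only in `0`; RRC is implied, by compactness of the unit sphere, by the same property
for the closures of these cones. It remains to see that the two properties agree for almost every
`A`. Multiplying the coordinates in `S` by `exp t` and the others by `exp (-t)`, with `t > 0`,
strictly increases the former and strictly decreases the latter where they are non-zero. If this
maps a non-zero vector of the closed cone into the kernel, its image lies in the cone itself, up to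
a perturbation at its zero coordinates, which can be made inside the kernel when the columns of `A`
are in general position. Hence if the kernel of `A` avoids the cone but not its closure, rescaling
the columns of `A` takes it at once out of the closed set of matrices whose kernel meets the closed
cone. Such exit points of a one-parameter flow form a null set, since its translates along the flow
are pairwise disjoint and uncountable in number.
-/

namespace FMin

section MeasureTheory

open Measure

lemma pi_absolutelyContinuous_pi {ι : Type*} [Fintype ι] {X : ι → Type*}
    [∀ i, MeasurableSpace (X i)] {μ ν : ∀ i, Measure (X i)} [∀ i, SigmaFinite (μ i)]
    [∀ i, SigmaFinite (ν i)] (h : ∀ i, μ i ≪ ν i) : Measure.pi μ ≪ Measure.pi ν := by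
  revert X
  refine Fintype.induction_empty_option (P := fun ι _ => ∀ {X : ι → Type _}
    [∀ i, MeasurableSpace (X i)] {μ ν : ∀ i, Measure (X i)} [∀ i, SigmaFinite (μ i)]
    [∀ i, SigmaFinite (ν i)], (∀ i, μ i ≪ ν i) → Measure.pi μ ≪ Measure.pi ν) ?_ ?_ ?_ ι
  · intro α β _ e ih X _ μ ν _ _ h
    let _ : Fintype α := Fintype.ofEquiv β e.symm
    rw [← (measurePreserving_piCongrLeft μ e).map_eq, ← (measurePreserving_piCongrLeft ν e).map_eq]
    exact (ih fun i => h (e i)).map (MeasurableEquiv.measurable _)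
  · intro X _ μ ν _ _ _
    rw [pi_of_empty μ, pi_of_empty ν]
  · intro α _ ih X _ μ ν _ _ h
    rw [← pi_map_piOptionEquivProd μ, ← pi_map_piOptionEquivProd ν]
    exact ((ih fun i => h (some i)).prod (h none)).map (MeasurableEquiv.measurable _)

/-- The orbits meet the set of points that leave `G` at once in at most one point each, so its
preimages under the uncountably many maps of the flow are pairwise disjoint. -/
lemma ae_exists_pos_mem_of_flow {α : Type*} [MeasurableSpace α] {μ : Measure α} [SFinite μ]
    {φ : ℝ → α → α} (hφ0 : ∀ x, φ 0 x = x) (hφ : ∀ s t x, φ (s + t) x = φ s (φ t x))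
    (hqmp : ∀ t, QuasiMeasurePreserving (φ t) μ μ) {G : Set α} (hG : MeasurableSet G)
    (hback : ∀ t, 0 ≤ t → ∀ x, φ t x ∈ G → x ∈ G) :
    ∀ᵐ x ∂μ, x ∈ G → ∃ t, 0 < t ∧ φ t x ∈ G := by
  let E : Set α := {x | x ∈ G ∧ ∀ t, 0 < t → φ t x ∉ G}
  have hE_eq : E = G ∩ ⋂ N : ℕ, φ (1 / (N + 1)) ⁻¹' Gᶜ := by
    ext x
    refine and_congr_right fun _ => ?_
    simp only [Set.mem_iInter, Set.mem_preimage, Set.mem_compl_iff]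
    refine ⟨fun h N => h _ Nat.one_div_pos_of_nat, fun h t ht htx => ?_⟩
    obtain ⟨N, hN⟩ := exists_nat_one_div_lt ht
    refine h N (hback (t - 1 / (N + 1)) (by linarith) _ ?_)
    rwa [← hφ, sub_add_cancel]
  have hE : MeasurableSet E := hE_eq ▸
    hG.inter (MeasurableSet.iInter fun N => (hqmp _).measurable hG.compl)
  have hdisj_lt {s t : ℝ} (hst : s < t) : Disjoint (φ s ⁻¹' E) (φ t ⁻¹' E) :=
    Set.disjoint_left.2 fun x hs ht => hs.2 (t - s) (sub_pos.2 hst) <| by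
      rw [← hφ, sub_add_cancel]
      exact ht.1
  have hdisj : Pairwise (Function.onFun Disjoint fun t => φ t ⁻¹' E) := fun s t hst =>
    (lt_or_gt_of_ne hst).elim hdisj_lt fun h => (hdisj_lt h).symm
  obtain ⟨t, ht⟩ : ∃ t, μ (φ t ⁻¹' E) = 0 := by
    by_contra! hpos
    refine Set.not_countable_univ ((countable_meas_pos_of_disjoint_iUnion
      (fun t => (hqmp t).measurable hE) hdisj).mono fun t _ => (hpos t).bot_lt)
  have hE_null : μ E = 0 := by
    have h_preimage : φ (-t) ⁻¹' (φ t ⁻¹' E) = E := by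
      ext x
      rw [Set.mem_preimage, Set.mem_preimage, ← hφ, add_neg_cancel, hφ0]
    exact h_preimage ▸ (hqmp (-t)).preimage_null ht
  filter_upwards [measure_eq_zero_iff_ae_notMem.1 hE_null] with x hx hxG
  by_contra! h
  exact hx ⟨hxG, h⟩

lemma quasiMeasurePreserving_linearEquiv {E E' : Type*} [NormedAddCommGroup E] [NormedSpace ℝ E]
    [FiniteDimensional ℝ E] [MeasurableSpace E] [BorelSpace E] [NormedAddCommGroup E']
    [NormedSpace ℝ E'] [MeasurableSpace E'] [BorelSpace E'] (μ : Measure E) [μ.IsAddHaarMeasure]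
    (ν : Measure E') [ν.IsAddHaarMeasure] (e : E ≃ₗ[ℝ] E') : QuasiMeasurePreserving e μ ν := by
  have := e.finiteDimensional
  have := e.isAddHaarMeasure_map μ
  exact ⟨e.toContinuousLinearEquiv.continuous.measurable,
    absolutelyContinuous_isAddHaarMeasure _ _⟩

open Polynomial in
lemma ae_det_apply_ne_zero {E ν : Type*} [NormedAddCommGroup E] [NormedSpace ℝ E]
    [FiniteDimensional ℝ E] [MeasurableSpace E] [BorelSpace E] (μ : Measure E)
    [μ.IsAddHaarMeasure] [Fintype ν] [DecidableEq ν] (L : E →ₗ[ℝ] Matrix ν ν ℝ) {x₀ : E}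
    (h : (L x₀).det ≠ 0) : ∀ᵐ x ∂μ, (L x).det ≠ 0 := by
  let U : Set E := {x | (L x).det ≠ 0}
  have hU : IsOpen U :=
    isOpen_ne_fun L.continuous_of_finiteDimensional.matrix_det continuous_const
  refine ae_mem_of_ae_add_linearMap_mem (s := U) (LinearMap.toSpanSingleton ℝ E x₀) volume μ
    hU.measurableSet fun x => ?_
  let p : ℝ[X] := ((X : ℝ[X]) • (L x₀).map C + (L x).map C).det
  have hp : p ≠ 0 := fun hp => h <| (coeff_det_X_add_C_card (L x₀) (L x)).symm.trans <|
    congrArg (coeff · (Fintype.card ν)) hp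
  have heval (t : ℝ) : (L (x + t • x₀)).det = p.eval t := by
    rw [← coe_evalRingHom, RingHom.map_det]
    congr 1
    ext i j
    simp [add_comm (L x i j), mul_comm t]
  filter_upwards [(finite_setOfPred_isRoot hp).measure_zero volume |> compl_mem_ae_iff.2]
    with t ht ht_det
  exact ht ((heval t).symm.trans ht_det)

end MeasureTheory

section GeneralPosition

lemma mulVec_eq_sum_smul_col {ι κ : Type*} [Fintype κ] (A : Matrix ι κ ℝ) {T : Finset κ}
    {x : κ → ℝ} (hx : ∀ j ∉ T, x j = 0) : A.mulVec x = ∑ j ∈ T, x j • A.col j := by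
  rw [Finset.sum_subset T.subset_univ fun j _ hj => by rw [hx j hj, zero_smul]]
  ext i
  simp [Matrix.mulVec, dotProduct, mul_comm]

variable {ι κ : Type*} [Fintype ι] [Fintype κ]

lemma map_absolutelyContinuous_of_iIndepFun {Ω : Type*} [MeasurableSpace Ω] {P : Measure Ω}
    {A : Ω → ι → κ → ℝ} (hA : AEMeasurable A P)
    (hind : iIndepFun (fun (p : ι × κ) ω => A ω p.1 p.2) P)
    (hac : ∀ i j, P.map (fun ω => A ω i j) ≪ volume) : P.map A ≪ volume := by
  have := hind.isProbabilityMeasure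
  let e : (ι × κ → ℝ) ≃ₗ[ℝ] ι → κ → ℝ := LinearEquiv.curry ℝ ℝ ι κ
  have he : Measure.QuasiMeasurePreserving e := quasiMeasurePreserving_linearEquiv _ _ e
  have hentry (p : ι × κ) : AEMeasurable (fun ω => A ω p.1 p.2) P := by fun_prop
  have (p : ι × κ) : IsProbabilityMeasure (P.map fun ω => A ω p.1 p.2) :=
    Measure.isProbabilityMeasure_map (hentry p)
  have hlaw : P.map A = (Measure.pi fun p : ι × κ => P.map fun ω => A ω p.1 p.2).map e := by
    rw [← hind.map_fun_eq_pi_map hentry, AEMeasurable.map_map_of_aemeasurable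
      he.measurable.aemeasurable (aemeasurable_pi_lambda _ hentry)]
    rfl
  rw [hlaw]
  exact ((pi_absolutelyContinuous_pi fun p => hac p.1 p.2).map he.measurable).trans
    he.absolutelyContinuous

/-- The columns of `A` are in general position: any `Fintype.card ι` of them, or fewer, are
linearly independent. -/
def ColumnsInGeneralPosition {ι κ : Type*} [Fintype ι] (A : Matrix ι κ ℝ) : Prop :=
  ∀ T : Finset κ, T.card ≤ Fintype.card ι → LinearIndepOn ℝ A.col T

lemma ae_columnsInGeneralPosition :
    ∀ᵐ A : ι → κ → ℝ, ColumnsInGeneralPosition (Matrix.of A) := by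
  classical
  have hdet (T : Finset κ) (e : T ↪ ι) :
      ∀ᵐ A : ι → κ → ℝ, ((Matrix.of A).submatrix e ((↑) : T → κ)).det ≠ 0 := by
    let L : (ι → κ → ℝ) →ₗ[ℝ] Matrix T T ℝ :=
      { toFun := fun A => (Matrix.of A).submatrix e (↑)
        map_add' := fun _ _ => rfl
        map_smul' := fun _ _ => rfl }
    let M : ι → κ → ℝ := fun i j => if ∃ l : T, e l = i ∧ l = j then 1 else 0
    have hM : L M = 1 := by
      ext a b
      exact if_congr (by simp [e.injective.eq_iff]) rfl rfl
    exact ae_det_apply_ne_zero volume L (x₀ := M) (by simp [hM])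
  filter_upwards [ae_all_iff.2 fun T => ae_all_iff.2 (hdet T)] with A hA T hT
  obtain ⟨e⟩ : Nonempty (T ↪ ι) :=
    Function.Embedding.nonempty_of_card_le (by simpa using hT)
  exact LinearIndependent.of_comp (LinearMap.funLeft ℝ ℝ e)
    (Matrix.linearIndependent_cols_of_det_ne_zero (hA T e))

lemma ColumnsInGeneralPosition.card_lt_of_mulVec_eq_zero {A : Matrix ι κ ℝ}
    (hA : ColumnsInGeneralPosition A) {T : Finset κ} {y : κ → ℝ} (hyT : ∀ j ∉ T, y j = 0)
    (hy : y ≠ 0) (hAy : A.mulVec y = 0) : Fintype.card ι < T.card := by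
  by_contra! hT
  rw [mulVec_eq_sum_smul_col A hyT] at hAy
  have hyT' : ∀ j ∈ T, y j = 0 := linearIndepOn_finset_iff.1 (hA T hT) y hAy
  exact hy (funext fun j => (em (j ∈ T)).elim (hyT' j) (hyT j))

lemma ColumnsInGeneralPosition.exists_mulVec_eq {A : Matrix ι κ ℝ}
    (hA : ColumnsInGeneralPosition A) {T : Finset κ} (hT : Fintype.card ι ≤ T.card) (b : ι → ℝ) :
    ∃ x : κ → ℝ, (∀ j ∉ T, x j = 0) ∧ A.mulVec x = b := by
  classical
  obtain ⟨T', hT', hcard⟩ := Finset.exists_subset_card_eq hT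
  have hspan : Submodule.span ℝ (A.col '' T') = ⊤ := by
    rw [Set.image_eq_range]
    exact (hA T' hcard.le).span_eq_top_of_card_eq_finrank' (by simpa using hcard)
  obtain ⟨c, hc⟩ := (Submodule.mem_span_image_finset_iff_exists_fun' ℝ).1
    (hspan ▸ Submodule.mem_top : b ∈ Submodule.span ℝ (A.col '' T'))
  refine ⟨fun j => if j ∈ T' then c j else 0, fun j hj => if_neg (mt (@hT' j) hj), ?_⟩
  rw [mulVec_eq_sum_smul_col A fun j hj => if_neg hj, ← hc]
  exact Finset.sum_congr rfl fun j hj => by rw [if_pos hj]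

lemma ColumnsInGeneralPosition.exists_mulVec_eq_zero_eq_on_zeros {A : Matrix ι κ ℝ}
    (hA : ColumnsInGeneralPosition A) {y : κ → ℝ} (hy : y ≠ 0) (hAy : A.mulVec y = 0)
    (e : κ → ℝ) : ∃ u : κ → ℝ, A.mulVec u = 0 ∧ ∀ j, y j = 0 → u j = e j := by
  classical
  let T : Finset κ := {j | y j ≠ 0}
  have hyT : ∀ j ∉ T, y j = 0 := by simp [T]
  obtain ⟨x, hx, hxe⟩ :=
    hA.exists_mulVec_eq (hA.card_lt_of_mulVec_eq_zero hyT hy hAy).le (-A.mulVec e)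
  refine ⟨x + e, by rw [Matrix.mulVec_add, hxe, neg_add_cancel], fun j hj => ?_⟩
  rw [Pi.add_apply, hx j (by simpa [T] using hj), zero_add]

end GeneralPosition

section Cones

open Filter Topology

lemma exists_pos_forall_mul_norm_le {E E' : Type*} [NormedAddCommGroup E] [NormedSpace ℝ E]
    [FiniteDimensional ℝ E] [NormedAddCommGroup E'] [NormedSpace ℝ E'] (f : E →ₗ[ℝ] E') {C : Set E}
    (hC : IsClosed C) (hsmul : ∀ c : ℝ, 0 < c → ∀ z ∈ C, c • z ∈ C)
    (hf : ∀ z ∈ C, f z = 0 → z = 0) : ∃ c : ℝ, 0 < c ∧ ∀ z ∈ C, c * ‖z‖ ≤ ‖f z‖ := by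
  have hcomp : IsCompact (Metric.sphere 0 1 ∩ C) := (isCompact_sphere _ _).inter_right hC
  have hcont : ContinuousOn (‖f ·‖) (Metric.sphere 0 1 ∩ C) :=
    f.continuous_of_finiteDimensional.norm.continuousOn
  obtain ⟨c, hc, hle⟩ := hcomp.exists_forall_le' (a := 0) hcont fun z hz =>
    norm_pos_iff.2 fun h0 => Metric.ne_of_mem_sphere hz.1 one_ne_zero (hf z hz.2 h0)
  refine ⟨c, hc, fun z hz => ?_⟩
  rcases eq_or_ne z 0 with rfl | h0
  · simp
  have hpos : 0 < ‖z‖ := norm_pos_iff.2 h0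
  have hunit : ‖z‖⁻¹ • z ∈ Metric.sphere 0 1 ∩ C :=
    ⟨by simp [norm_smul, hpos.ne'], hsmul _ (inv_pos.2 hpos) z hz⟩
  have := hle _ hunit
  rwa [map_smul, norm_smul, norm_inv, norm_norm, inv_mul_eq_div, le_div_iff₀ hpos] at this

variable {κ : Type*} [Fintype κ] [DecidableEq κ]

/-- The kernel of the matrix contains no non-zero element of the set `C` of vectors. -/
def KernelAvoids {ι : Type*} (A : Matrix ι κ ℝ) (C : Set (EuclideanSpace ℝ κ)) : Prop :=
  ∀ z ∈ C, A.toEuclideanLin z = 0 → z = 0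

lemma isOpen_kernelAvoids {ι : Type*} {C : Set (EuclideanSpace ℝ κ)} (hC : IsClosed C)
    (hsmul : ∀ c : ℝ, 0 < c → ∀ z ∈ C, c • z ∈ C) :
    IsOpen {A : Matrix ι κ ℝ | KernelAvoids A C} := by
  let X : Set (EuclideanSpace ℝ κ) := Metric.sphere 0 1 ∩ C
  have : CompactSpace X := isCompact_iff_compactSpace.1 ((isCompact_sphere _ _).inter_right hC)
  have hker : IsClosed {p : X × Matrix ι κ ℝ | p.2.mulVec (p.1 : EuclideanSpace ℝ κ).ofLp = 0} :=
    isClosed_eq (by fun_prop) continuous_const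
  rw [← isClosed_compl_iff]
  convert isClosedMap_snd_of_compactSpace _ hker using 1
  ext A
  simp only [KernelAvoids, Set.mem_compl_iff, Set.mem_ofPred_eq, not_forall, Set.mem_image,
    Prod.exists, exists_eq_right, Subtype.exists]
  constructor
  · rintro ⟨z, hz, hAz, h0⟩
    refine ⟨‖z‖⁻¹ • z, ⟨by simp [norm_smul, h0], hsmul _ (by positivity) z hz⟩, ?_⟩
    have : A.mulVec z.ofLp = 0 := congrArg WithLp.ofLp hAz
    simp [Matrix.mulVec_smul, this]
  · rintro ⟨z, ⟨hz1, hz⟩, hAz⟩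
    exact ⟨z, hz, congrArg (WithLp.toLp 2) hAz, Metric.ne_of_mem_sphere hz1 one_ne_zero⟩

/-- The cone generated by the vectors whose cost on `S` is at least their cost off `S`. -/
def concentratedCone (F : ℝ≥0 → ℝ≥0) (S : Finset κ) : Set (EuclideanSpace ℝ κ) :=
  {z | ∃ t : ℝ, 0 < t ∧
    ∑ i ∈ Sᶜ, F (Real.nnabs (t * z i)) ≤ ∑ i ∈ S, F (Real.nnabs (t * z i))}

variable {F : ℝ≥0 → ℝ≥0} {S : Finset κ} {z w : EuclideanSpace ℝ κ}

lemma smul_mem_concentratedCone {c : ℝ} (hc : 0 < c) (hz : z ∈ concentratedCone F S) :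
    c • z ∈ concentratedCone F S := by
  obtain ⟨t, ht, h⟩ := hz
  refine ⟨t / c, by positivity, ?_⟩
  have hcancel (i : κ) : t / c * (c • z) i = t * z i := by
    rw [PiLp.smul_apply, smul_eq_mul, ← mul_assoc, div_mul_cancel₀ t hc.ne']
  simpa only [hcancel] using h

lemma smul_mem_closure_concentratedCone {c : ℝ} (hc : 0 < c)
    (hz : z ∈ closure (concentratedCone F S)) : c • z ∈ closure (concentratedCone F S) :=
  map_mem_closure (continuous_const_smul c) hz fun _ => smul_mem_concentratedCone hc

lemma concentratedCone_of_abs_le (hF : Monotone F) (hz : z ∈ concentratedCone F S)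
    (hS : ∀ i ∈ S, |z i| ≤ |w i|) (hSc : ∀ i ∉ S, |w i| ≤ |z i|) : w ∈ concentratedCone F S := by
  obtain ⟨t, ht, h⟩ := hz
  have hle {x y : ℝ} (hxy : |x| ≤ |y|) : F (Real.nnabs (t * x)) ≤ F (Real.nnabs (t * y)) := by
    refine hF (NNReal.coe_le_coe.1 ?_)
    simpa only [Real.coe_nnabs, abs_mul] using mul_le_mul_of_nonneg_left hxy (abs_nonneg t)
  refine ⟨t, ht, ?_⟩
  calc ∑ i ∈ Sᶜ, F (Real.nnabs (t * w i)) ≤ ∑ i ∈ Sᶜ, F (Real.nnabs (t * z i)) :=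
        Finset.sum_le_sum fun i hi => hle (hSc i (Finset.mem_compl.1 hi))
    _ ≤ ∑ i ∈ S, F (Real.nnabs (t * z i)) := h
    _ ≤ ∑ i ∈ S, F (Real.nnabs (t * w i)) := Finset.sum_le_sum fun i hi => hle (hS i hi)

lemma mem_concentratedCone_of_mem_closure (hF : Monotone F)
    (hz : z ∈ closure (concentratedCone F S)) (hS : ∀ i ∈ S, |z i| < |w i|)
    (hSc : ∀ i ∉ S, w i = 0 ∨ |w i| < |z i|) : w ∈ concentratedCone F S := by
  have hlim (i : κ) : Tendsto (fun b : EuclideanSpace ℝ κ => |b i|) (𝓝 z) (𝓝 |z i|) :=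
    Continuous.tendsto (by fun_prop) z
  have hnear_mem : ∀ᶠ b in 𝓝 z, ∀ i ∈ S, |b i| ≤ |w i| :=
    S.eventually_all.2 fun i hi => (hlim i).eventually_le_const (hS i hi)
  have hnear_notMem : ∀ᶠ b in 𝓝 z, ∀ i ∈ Sᶜ, |w i| ≤ |b i| := by
    refine Sᶜ.eventually_all.2 fun i hi => ?_
    rcases hSc i (Finset.mem_compl.1 hi) with h0 | hlt
    · simp [h0]
    · exact (hlim i).eventually_const_le hlt
  obtain ⟨b, hb, hbS, hbSc⟩ := ((mem_closure_iff_frequently.1 hz).and_eventually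
    (hnear_mem.and hnear_notMem)).exists
  exact concentratedCone_of_abs_le hF hb hbS fun i hi => hbSc i (Finset.mem_compl.2 hi)

end Cones

section Scaling

variable {ι κ : Type*} [DecidableEq κ]

/-- The diagonal matrix that, for `t > 0`, enlarges the coordinates in `S` and shrinks the
others. -/
noncomputable def columnScaling (S : Finset κ) (t : ℝ) : Matrix κ κ ℝ :=
  Matrix.diagonal fun j => Real.exp (if j ∈ S then t else -t)

lemma columnScaling_zero (S : Finset κ) : columnScaling S 0 = 1 := by
  simp [columnScaling]

variable [Fintype κ] (S : Finset κ)

lemma columnScaling_mul_columnScaling (s t : ℝ) :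
    columnScaling S s * columnScaling S t = columnScaling S (s + t) := by
  simp only [columnScaling, Matrix.diagonal_mul_diagonal, ← Real.exp_add]
  congr! 3
  split_ifs <;> ring

/-- The flow on the space of matrices that rescales the columns by `columnScaling S`. -/
noncomputable def columnFlow (t : ℝ) : (ι → κ → ℝ) ≃ₗ[ℝ] ι → κ → ℝ where
  toFun A := Matrix.of A * columnScaling S t
  invFun A := Matrix.of A * columnScaling S (-t)
  map_add' A B := Matrix.add_mul (.of A) (.of B) _
  map_smul' c A := Matrix.smul_mul c (.of A) _
  left_inv A := by
    change Matrix.of A * columnScaling S t * columnScaling S (-t) = _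
    rw [Matrix.mul_assoc, columnScaling_mul_columnScaling, add_neg_cancel, columnScaling_zero,
      Matrix.mul_one]
    rfl
  right_inv A := by
    change Matrix.of A * columnScaling S (-t) * columnScaling S t = _
    rw [Matrix.mul_assoc, columnScaling_mul_columnScaling, neg_add_cancel, columnScaling_zero,
      Matrix.mul_one]
    rfl

lemma columnFlow_zero (A : ι → κ → ℝ) : columnFlow S 0 A = A := by
  change Matrix.of A * columnScaling S 0 = A
  rw [columnScaling_zero, Matrix.mul_one]
  rfl

lemma columnFlow_add (s t : ℝ) (A : ι → κ → ℝ) :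
    columnFlow S (s + t) A = columnFlow S s (columnFlow S t A) := by
  change Matrix.of A * columnScaling S (s + t) =
    Matrix.of A * columnScaling S t * columnScaling S s
  rw [Matrix.mul_assoc, columnScaling_mul_columnScaling, add_comm]

lemma toEuclideanLin_columnFlow (t : ℝ) (A : ι → κ → ℝ) (z : EuclideanSpace ℝ κ) :
    (Matrix.of (columnFlow S t A)).toEuclideanLin z =
      (Matrix.of A).toEuclideanLin ((columnScaling S t).toEuclideanLin z) :=
  congrArg (WithLp.toLp 2) (Matrix.mulVec_mulVec z.ofLp (.of A) (columnScaling S t)).symm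

variable {S} {z : EuclideanSpace ℝ κ}

lemma abs_toEuclideanLin_columnScaling_of_mem (t : ℝ) {j : κ} (hj : j ∈ S) :
    |(columnScaling S t).toEuclideanLin z j| = Real.exp t * |z j| := by
  simp [columnScaling, Matrix.mulVec_diagonal, hj, abs_mul]

lemma abs_toEuclideanLin_columnScaling_of_notMem (t : ℝ) {j : κ} (hj : j ∉ S) :
    |(columnScaling S t).toEuclideanLin z j| = Real.exp (-t) * |z j| := by
  simp [columnScaling, Matrix.mulVec_diagonal, hj, abs_mul]

lemma toEuclideanLin_columnScaling_apply_eq_zero_iff {t : ℝ} {j : κ} :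
    (columnScaling S t).toEuclideanLin z j = 0 ↔ z j = 0 := by
  simp [columnScaling, Matrix.mulVec_diagonal]

end Scaling

section Genericity

open Filter Topology

lemma exists_add_smul_strictly_dominating {κ : Type*} [Finite κ] {S : Set κ}
    {y z u : κ → ℝ} (hy : y ≠ 0) (hyz : ∀ i, z i = 0 → y i = 0)
    (hS : ∀ i ∈ S, z i ≠ 0 → |z i| < |y i|)
    (hSc : ∀ i ∉ S, z i ≠ 0 → |y i| < |z i|) (huS : ∀ i ∈ S, z i = 0 → u i ≠ 0)
    (huSc : ∀ i ∉ S, z i = 0 → u i = 0) :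
    ∃ δ : ℝ, y + δ • u ≠ 0 ∧ (∀ i ∈ S, |z i| < |(y + δ • u) i|) ∧
      ∀ i ∉ S, (y + δ • u) i = 0 ∨ |(y + δ • u) i| < |z i| := by
  have hlim : Tendsto (fun δ : ℝ => y + δ • u) (𝓝[≠] 0) (𝓝 y) :=
    tendsto_nhdsWithin_of_tendsto_nhds (Continuous.tendsto' (by fun_prop) _ _ (by simp))
  have hlim_abs (i : κ) : Tendsto (fun δ : ℝ => |(y + δ • u) i|) (𝓝[≠] 0) (𝓝 |y i|) :=
    ((continuous_apply i).abs.tendsto y).comp hlim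
  have hnear_mem : ∀ᶠ δ : ℝ in 𝓝[≠] 0, ∀ i ∈ S, |z i| < |(y + δ • u) i| := by
    refine eventually_all.2 fun i => eventually_imp_distrib_left.2 fun hi => ?_
    by_cases hzi : z i = 0
    · filter_upwards [self_mem_nhdsWithin] with δ (hδ : δ ≠ 0)
      simp [hzi, hyz i hzi, hδ, huS i hi hzi]
    · exact (hlim_abs i).eventually_const_lt (hS i hi hzi)
  have hnear_notMem : ∀ᶠ δ : ℝ in 𝓝[≠] 0,
      ∀ i ∉ S, (y + δ • u) i = 0 ∨ |(y + δ • u) i| < |z i| := by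
    refine eventually_all.2 fun i => eventually_imp_distrib_left.2 fun hi => ?_
    by_cases hzi : z i = 0
    · simp [hyz i hzi, huSc i hi hzi]
    · exact ((hlim_abs i).eventually_lt_const (hSc i hi hzi)).mono fun _ => Or.inr
  exact ((hlim.eventually_ne hy).and (hnear_mem.and hnear_notMem)).exists

variable {ι κ : Type*} [Fintype κ] [DecidableEq κ] {F : ℝ≥0 → ℝ≥0} {S : Finset κ}

lemma toEuclideanLin_columnScaling_mem_closure (hF : Monotone F) {t : ℝ} (ht : 0 ≤ t)
    {z : EuclideanSpace ℝ κ} (hz : z ∈ closure (concentratedCone F S)) :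
    (columnScaling S t).toEuclideanLin z ∈ closure (concentratedCone F S) := by
  refine map_mem_closure (LinearMap.continuous_of_finiteDimensional _) hz fun w hw =>
    concentratedCone_of_abs_le hF hw (fun i hi => ?_) fun i hi => ?_
  · rw [abs_toEuclideanLin_columnScaling_of_mem t hi]
    exact le_mul_of_one_le_left (abs_nonneg _) (Real.one_le_exp ht)
  · rw [abs_toEuclideanLin_columnScaling_of_notMem t hi]
    exact mul_le_of_le_one_left (abs_nonneg _) (Real.exp_le_one_iff.2 (neg_nonpos.2 ht))

lemma kernelAvoids_closure_columnFlow (hF : Monotone F) {t : ℝ} (ht : 0 ≤ t) {A : ι → κ → ℝ}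
    (hA : KernelAvoids (.of A) (closure (concentratedCone F S))) :
    KernelAvoids (.of (columnFlow S t A)) (closure (concentratedCone F S)) := by
  intro z hz hAz
  rw [toEuclideanLin_columnFlow] at hAz
  have hDz := hA _ (toEuclideanLin_columnScaling_mem_closure hF ht hz) hAz
  ext i
  exact toEuclideanLin_columnScaling_apply_eq_zero_iff.1 (congrArg (· i) hDz)

variable [Fintype ι]

lemma ColumnsInGeneralPosition.kernelAvoids_closure_columnFlow {A : ι → κ → ℝ}
    (hgen : ColumnsInGeneralPosition (.of A)) (hF : Monotone F) {t : ℝ} (ht : 0 < t)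
    (hA : KernelAvoids (.of A) (concentratedCone F S)) :
    KernelAvoids (.of (columnFlow S t A)) (closure (concentratedCone F S)) := by
  intro z hz hAz
  by_contra h0
  rw [toEuclideanLin_columnFlow] at hAz
  let y : EuclideanSpace ℝ κ := (columnScaling S t).toEuclideanLin z
  have hyz (i : κ) : y i = 0 ↔ z i = 0 := toEuclideanLin_columnScaling_apply_eq_zero_iff
  have hy : y.ofLp ≠ 0 := fun hy => h0 (by ext i; exact (hyz i).1 (congrFun hy i))
  have hAy : (Matrix.of A).mulVec y.ofLp = 0 := congrArg WithLp.ofLp hAz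
  obtain ⟨u, hAu, hu⟩ :=
    hgen.exists_mulVec_eq_zero_eq_on_zeros hy hAy fun i => if i ∈ S then 1 else 0
  obtain ⟨δ, hw0, hwS, hwSc⟩ := exists_add_smul_strictly_dominating (S := (S : Set κ)) (u := u)
    hy (fun i => (hyz i).2)
    (fun i hi hzi => by
      rw [abs_toEuclideanLin_columnScaling_of_mem t hi]
      exact lt_mul_of_one_lt_left (abs_pos.2 hzi) (Real.one_lt_exp_iff.2 ht))
    (fun i hi hzi => by
      rw [abs_toEuclideanLin_columnScaling_of_notMem t hi]
      exact mul_lt_of_lt_one_left (abs_pos.2 hzi) (Real.exp_lt_one_iff.2 (neg_neg_of_pos ht)))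
    (fun i hi hzi => by simpa [hu i ((hyz i).2 hzi)] using hi)
    (fun i hi hzi => by simpa [hu i ((hyz i).2 hzi)] using hi)
  have hw : WithLp.toLp 2 (y.ofLp + δ • u) ∈ concentratedCone F S :=
    mem_concentratedCone_of_mem_closure hF hz hwS hwSc
  have hAw : (Matrix.of A).mulVec (y.ofLp + δ • u) = 0 := by
    rw [Matrix.mulVec_add, Matrix.mulVec_smul, hAy, hAu, smul_zero, add_zero]
  exact hw0 (congrArg WithLp.ofLp (hA _ hw (congrArg (WithLp.toLp 2) hAw)))

lemma ae_kernelAvoids_closure (hF : Monotone F) (S : Finset κ) :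
    ∀ᵐ A : ι → κ → ℝ, KernelAvoids (.of A) (concentratedCone F S) →
      KernelAvoids (.of A) (closure (concentratedCone F S)) := by
  let C : Set (EuclideanSpace ℝ κ) := closure (concentratedCone F S)
  let G : Set (ι → κ → ℝ) := {A | KernelAvoids (.of A) C}ᶜ
  have hG : IsClosed G := IsOpen.isClosed_compl (isOpen_kernelAvoids (ι := ι) (C := C)
    isClosed_closure fun c hc z => smul_mem_closure_concentratedCone hc)
  have hqmp (t : ℝ) : Measure.QuasiMeasurePreserving (columnFlow (ι := ι) S t) :=
    quasiMeasurePreserving_linearEquiv (E := ι → κ → ℝ) (E' := ι → κ → ℝ) volume volume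
      (columnFlow S t)
  have hflow : ∀ᵐ A : ι → κ → ℝ, A ∈ G → ∃ t, 0 < t ∧ columnFlow S t A ∈ G :=
    ae_exists_pos_mem_of_flow (φ := fun t => columnFlow S t) (columnFlow_zero S) (columnFlow_add S)
      hqmp hG.measurableSet fun t ht A => mt (kernelAvoids_closure_columnFlow hF ht)
  filter_upwards [ae_columnsInGeneralPosition, hflow] with A hgen hflowA hA
  by_contra hAG
  obtain ⟨t, ht, htG⟩ := hflowA hAG
  exact htG (hgen.kernelAvoids_closure_columnFlow hF ht hA)

end Genericity

section Recovery

variable {m n k : ℕ} {F : ℝ≥0 → ℝ≥0} {A : Matrix (Fin m) (Fin n) ℝ}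

/-- The null space property: no non-zero kernel vector has, after rescaling, at least as large a
cost on `k` coordinates as on the others. -/
def NullSpaceProperty (F : ℝ≥0 → ℝ≥0) (k : ℕ) (A : Matrix (Fin m) (Fin n) ℝ) : Prop :=
  ∀ S : Finset (Fin n), S.card ≤ k → KernelAvoids A (concentratedCone F S)

/-- The null space property for the closed cones; unlike `NullSpaceProperty`, it is an open
condition on `A`. -/
def ClosedNullSpaceProperty (F : ℝ≥0 → ℝ≥0) (k : ℕ) (A : Matrix (Fin m) (Fin n) ℝ) : Prop :=
  ∀ S : Finset (Fin n), S.card ≤ k → KernelAvoids A (closure (concentratedCone F S))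

lemma isSparse_iff_exists_finset {x : EuclideanSpace ℝ (Fin n)} :
    IsSparse k x ↔ ∃ S : Finset (Fin n), S.card ≤ k ∧ ∀ i ∉ S, x i = 0 := by
  classical
  refine ⟨fun hx => ⟨Finset.univ.filter (x · ≠ 0), ?_, by simp⟩, fun ⟨S, hS, hx⟩ => ?_⟩
  · simpa [IsSparse, Set.ncard_eq_toFinset_card'] using hx
  · rw [← Set.ncard_coe_finset] at hS
    exact (Set.ncard_le_ncard fun i hi => not_imp_comm.1 (hx i) hi).trans hS

lemma erc_iff : ERC F k A ↔ ∀ x y : EuclideanSpace ℝ (Fin n), IsSparse k x →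
    A.toEuclideanLin y = A.toEuclideanLin x → cost F y ≤ cost F x → y = x := by
  constructor
  · intro h x y hx hyx hcost
    have hsol := (h x hx x).2 rfl
    exact (h x hx y).1 ⟨hyx, fun w hw => hcost.trans (hsol.2 w hw)⟩
  · refine fun h x hx y => ⟨fun hy => h x y hx hy.1 (hy.2 x rfl), ?_⟩
    rintro rfl
    refine ⟨rfl, fun w hw => (le_total _ _).elim id fun hle => ?_⟩
    rw [h y w hx hw hle]

lemma RRC.erc (h : RRC F k A) : ERC F k A := by
  obtain ⟨C, hC⟩ := h
  refine erc_iff.2 fun x y hx hyx hcost => ?_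
  have hlt (ε : ℝ) (hε : 0 < ε) : ‖x - y‖ < C * ε :=
    hC x y 0 ε hε hx (by simpa using hε.le) (by simpa [hyx] using hε) hcost
  have hlim : Filter.Tendsto (fun ε => C * ε) (nhdsWithin 0 (Set.Ioi 0)) (nhds 0) :=
    tendsto_nhdsWithin_of_tendsto_nhds (Continuous.tendsto' (by fun_prop) _ _ (by simp))
  have hle : ‖x - y‖ ≤ 0 := ge_of_tendsto hlim <|
    eventually_nhdsWithin_of_forall fun ε hε => (hlt ε hε).le
  exact (sub_eq_zero.1 (norm_le_zero_iff.1 hle)).symm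

lemma cost_eq_sum_of_forall_notMem (hF0 : F 0 = 0) {S : Finset (Fin n)}
    {x : EuclideanSpace ℝ (Fin n)} (hx : ∀ i ∉ S, x i = 0) :
    cost F x = ∑ i ∈ S, F (Real.nnabs (x i)) :=
  (Finset.sum_subset S.subset_univ fun i _ hi => by rw [hx i hi, map_zero, hF0]).symm

lemma ERC.nullSpaceProperty (hF0 : F 0 = 0) (h : ERC F k A) : NullSpaceProperty F k A := by
  rintro S hS z ⟨t, ht, hle⟩ hAz
  let x : EuclideanSpace ℝ (Fin n) := .toLp 2 fun i => if i ∈ S then -(t * z i) else 0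
  let y : EuclideanSpace ℝ (Fin n) := .toLp 2 fun i => if i ∈ S then 0 else t * z i
  have hyx : y - x = t • z := by
    ext i
    by_cases hi : i ∈ S <;> simp [x, y, hi]
  have hxS : ∀ i ∉ S, x i = 0 := fun i hi => if_neg hi
  have hySc : ∀ i ∉ Sᶜ, y i = 0 := fun i hi => if_pos (Finset.notMem_compl.1 hi)
  have hAyx : A.toEuclideanLin y = A.toEuclideanLin x := by
    rw [← sub_eq_zero, ← map_sub, hyx, map_smul, hAz, smul_zero]
  have hcost : cost F y ≤ cost F x := by
    rw [cost_eq_sum_of_forall_notMem hF0 hySc, cost_eq_sum_of_forall_notMem hF0 hxS]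
    convert hle using 1 <;> refine Finset.sum_congr rfl fun i hi => congrArg F (NNReal.eq ?_)
    · simp [y, Finset.mem_compl.1 hi]
    · simp [x, hi]
  have hsparse : IsSparse k x := isSparse_iff_exists_finset.2 ⟨S, hS, hxS⟩
  have hsmul : t • z = 0 := hyx ▸ sub_eq_zero.2 (erc_iff.1 h x y hsparse hAyx hcost)
  exact (smul_eq_zero.1 hsmul).resolve_left ht.ne'

lemma sub_mem_concentratedCone (hF0 : F 0 = 0)
    (hsub : ∀ x y : ℝ, F (Real.nnabs (x + y)) ≤ F (Real.nnabs x) + F (Real.nnabs y))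
    {S : Finset (Fin n)} {x y : EuclideanSpace ℝ (Fin n)} (hx : ∀ i ∉ S, x i = 0)
    (hcost : cost F y ≤ cost F x) : y - x ∈ concentratedCone F S := by
  have hxi (i : Fin n) :
      F (Real.nnabs (x i)) ≤ F (Real.nnabs (y i)) + F (Real.nnabs (y i - x i)) := by
    have hnn : Real.nnabs (y i - x i) = Real.nnabs (x i - y i) :=
      NNReal.eq (abs_sub_comm (y i) (x i))
    simpa [hnn] using hsub (y i) (x i - y i)
  have hle : ∑ i ∈ S, F (Real.nnabs (y i)) + ∑ i ∈ Sᶜ, F (Real.nnabs (y i)) ≤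
      ∑ i ∈ S, F (Real.nnabs (y i)) + ∑ i ∈ S, F (Real.nnabs (y i - x i)) :=
    calc _ = cost F y := Finset.sum_add_sum_compl S _
      _ ≤ cost F x := hcost
      _ = ∑ i ∈ S, F (Real.nnabs (x i)) := cost_eq_sum_of_forall_notMem hF0 hx
      _ ≤ _ := by
        rw [← Finset.sum_add_distrib]
        exact Finset.sum_le_sum fun i _ => hxi i
  refine ⟨1, one_pos, ?_⟩
  simp only [one_mul, PiLp.sub_apply]
  refine le_trans (Finset.sum_congr rfl fun i hi => ?_).le (le_of_add_le_add_left hle)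
  rw [hx i (Finset.mem_compl.1 hi), sub_zero]

lemma ClosedNullSpaceProperty.exists_mul_norm_le (h : ClosedNullSpaceProperty F k A) :
    ∃ c : ℝ, 0 < c ∧ ∀ S : Finset (Fin n), S.card ≤ k → ∀ z ∈ concentratedCone F S,
      c * ‖z‖ ≤ ‖A.toEuclideanLin z‖ := by
  have hS (S : Finset (Fin n)) : ∀ᶠ c in nhdsWithin (0 : ℝ) (Set.Ioi 0), S.card ≤ k →
      ∀ z ∈ concentratedCone F S, c * ‖z‖ ≤ ‖A.toEuclideanLin z‖ := by
    by_cases hS : S.card ≤ k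
    · obtain ⟨c, hc, hle⟩ := exists_pos_forall_mul_norm_le A.toEuclideanLin isClosed_closure
        (fun c hc z => smul_mem_closure_concentratedCone hc) (h S hS)
      filter_upwards [Ioo_mem_nhdsGT hc] with a ha _ z hz
      exact (mul_le_mul_of_nonneg_right ha.2.le (norm_nonneg z)).trans (hle z (subset_closure hz))
    · simp [hS]
  obtain ⟨c, hcS, hc⟩ := ((Filter.eventually_all.2 hS).and self_mem_nhdsWithin).exists
  exact ⟨c, hc, hcS⟩

lemma ClosedNullSpaceProperty.rrc (hF0 : F 0 = 0)
    (hsub : ∀ x y : ℝ, F (Real.nnabs (x + y)) ≤ F (Real.nnabs x) + F (Real.nnabs y))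
    (h : ClosedNullSpaceProperty F k A) : RRC F k A := by
  obtain ⟨c, hc, hle⟩ := h.exists_mul_norm_le
  refine ⟨2 / c, fun x y v ε _ hx hv hfeas hcost => ?_⟩
  obtain ⟨S, hS, hsupp⟩ := isSparse_iff_exists_finset.1 hx
  have hlower := hle S hS _ (sub_mem_concentratedCone hF0 hsub hsupp hcost)
  have hupper : ‖A.toEuclideanLin (y - x)‖ < 2 * ε :=
    calc ‖A.toEuclideanLin (y - x)‖
        = ‖A.toEuclideanLin y - (A.toEuclideanLin x + v) + v‖ := by rw [map_sub]; abel_nf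
      _ ≤ ‖A.toEuclideanLin y - (A.toEuclideanLin x + v)‖ + ‖v‖ := norm_add_le _ _
      _ < 2 * ε := by linarith
  rw [norm_sub_rev, div_mul_eq_mul_div, lt_div_iff₀ hc]
  linarith

lemma ae_closedNullSpaceProperty (hF : Monotone F) (m n k : ℕ) :
    ∀ᵐ A : Matrix (Fin m) (Fin n) ℝ, NullSpaceProperty F k A → ClosedNullSpaceProperty F k A := by
  filter_upwards [ae_all_iff.2 fun S : Finset (Fin n) => ae_kernelAvoids_closure (ι := Fin m) hF S]
    with A hA h S hS using hA S (h S hS)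

lemma measurableSet_closedNullSpaceProperty (F : ℝ≥0 → ℝ≥0) (m n k : ℕ) :
    MeasurableSet {A : Matrix (Fin m) (Fin n) ℝ | ClosedNullSpaceProperty F k A} := by
  have : BorelSpace (Matrix (Fin m) (Fin n) ℝ) :=
    inferInstanceAs (BorelSpace (Fin m → Fin n → ℝ))
  simp only [ClosedNullSpaceProperty, Set.ofPred_forall]
  exact .iInter fun S => .iInter fun _ => (isOpen_kernelAvoids isClosed_closure
    fun c hc z => smul_mem_closure_concentratedCone hc).measurableSet

lemma sameProbability_of_absolutelyContinuous {Ω : Type*} [MeasurableSpace Ω] {P : Measure Ω}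
    (hF0 : F 0 = 0)
    (hsub : ∀ x y : ℝ, F (Real.nnabs (x + y)) ≤ F (Real.nnabs x) + F (Real.nnabs y))
    (hmono : Monotone F) (k : ℕ) {A : Ω → Matrix (Fin m) (Fin n) ℝ} (hA : AEMeasurable A P)
    (hac : P.map A ≪ volume) : SameProbability P F k A := by
  let U : Set Ω := {ω | ClosedNullSpaceProperty F k (A ω)}
  have hU : NullMeasurableSet U P :=
    hA.nullMeasurableSet_preimage (measurableSet_closedNullSpaceProperty F m n k)
  have hclosed : ∀ᵐ ω ∂P, NullSpaceProperty F k (A ω) → ClosedNullSpaceProperty F k (A ω) :=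
    ae_of_ae_map hA (hac.ae_le (ae_closedNullSpaceProperty hmono m n k))
  have hERC : U =ᵐ[P] {ω | ERC F k (A ω)} := by
    filter_upwards [hclosed] with ω hω
    exact propext ⟨fun h => (h.rrc hF0 hsub).erc, fun h => hω (h.nullSpaceProperty hF0)⟩
  have hRRC : U =ᵐ[P] {ω | RRC F k (A ω)} := by
    filter_upwards [hclosed] with ω hω
    exact propext ⟨fun h => h.rrc hF0 hsub, fun h => hω (h.erc.nullSpaceProperty hF0)⟩
  exact ⟨hU.congr hERC, hU.congr hRRC, measure_congr (hERC.symm.trans hRRC)⟩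

end Recovery

end FMin

theorem corollary3_general {Ω : Type*} [MeasurableSpace Ω] (P : Measure Ω) (m n k : ℕ)
    (F : ℝ≥0 → ℝ≥0) (hF0 : F 0 = 0)
    (hsub : ∀ x y : ℝ, F (Real.nnabs (x + y)) ≤ F (Real.nnabs x) + F (Real.nnabs y))
    (hmono : Monotone F) (A : Ω → Matrix (Fin m) (Fin n) ℝ) (hA : AEMeasurable A P) :
    (P.map A ≪ volume → FMin.SameProbability P F k A) ∧
    (iIndepFun (fun (p : Fin m × Fin n) (ω : Ω) => A ω p.1 p.2) P →
      (∀ i j, P.map (fun ω => A ω i j) ≪ volume) → FMin.SameProbability P F k A) :=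
  ⟨FMin.sameProbability_of_absolutelyContinuous hF0 hsub hmono k hA, fun hind hac =>
    FMin.sameProbability_of_absolutelyContinuous hF0 hsub hmono k hA
      (FMin.map_absolutelyContinuous_of_iIndepFun hA hind hac)⟩

theorem corollary3 {Ω : Type*} [MeasurableSpace Ω] (P : Measure Ω) [IsProbabilityMeasure P]
    (m n k : ℕ) (F : ℝ≥0 → ℝ≥0) (hF : FMin.IsSparsenessMeasure F) (hmono : Monotone F)
    (A : Ω → Matrix (Fin m) (Fin n) ℝ) (hA : Measurable A) :
    (P.map A ≪ volume → FMin.SameProbability P F k A) ∧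
    (∀ ρ : Measure ℝ, ρ ≪ volume →
      iIndepFun (fun (p : Fin m × Fin n) (ω : Ω) => A ω p.1 p.2) P →
      (∀ i j, P.map (fun ω => A ω i j) = ρ) →
      FMin.SameProbability P F k A) :=
  (corollary3_general P m n k F ((hF.eq_zero_iff 0).2 rfl) hF.subadditive hmono A
    hA.aemeasurable).imp_right fun h _ hρ hind hlaw => h hind fun i j => hlaw i j ▸ hρ
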